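/- Let $\mathbb{R}^2_{++}=\{x\in\mathbb{R}^2 : x_1>0,\ x_2>0\}$ and define $g:\mathbb{R}^2_{++}\to\mathbb{R}^2$ and $u:\mathbb{R}^2_{++}\to\mathbb{R}$ by \[ g(x)=\left(1+\frac{x_1+1}{\sqrt{(x_1+1)^2+4x_2}},\ \frac{2}{\sqrt{(x_1+1)^2+4x_2}}\right),\qquad u(x)=(x_1-1)+\sqrt{(x_1+1)^2+4x_2}. \] For an open set $U\subset\mathbb{R}^n$ and a locally Lipschitz map $g:U\to\mathbb{R}^n\setminus\{0\}$, a function $w:V\to\mathbb{R}$ is called a normal solution to the total differential equation $\nabla w(x)=\lambda(x)g(x)$ if (1) its domain $V$ is open and contained in $U$; (2) $w$ is locally Lipschitz; (3) every level set of $w$ is an $(n-1)$-dimensional $C^1$ submanifold of $\mathbb{R}^n$; (4) $g$ is a normal vector field of every level set $X$ of $w$, i.e. $g(x)$ is orthogonal to the tangent space $T_x(X)$ for all $x\in X$; (5) $w$ has no local maximum point and no local minimum point; and (6) $\nabla w(x)\neq 0$ at every point $x$ at which $w$ is differentiable. Then $g$ is locally Lipschitz and nowhere zero on the open set $U=\mathbb{R}^2_{++}$,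 and $u$ is a normal solution for this $g$ with domain $\mathbb{R}^2_{++}$. Every normal solution for this $g$ with domain $\mathbb{R}^2_{++}$ is quasi-convex, but no normal solution for this $g$ with domain $\mathbb{R}^2_{++}$ is convex. -/

import Mathlib

/-- A map `f` on an arbitrary subset `X` of a Euclidean space is `C^k` if it is locally the
restriction of a `C^k` map defined on an open ball of the ambient space. -/
def IsCkOn {N M : ℕ} (k : ℕ) (X : Set (EuclideanSpace ℝ (Fin N)))
    (f : EuclideanSpace ℝ (Fin N) → EuclideanSpace ℝ (Fin M)) : Prop :=
  ∀ x ∈ X, ∃ r > 0, ∃ F : EuclideanSpace ℝ (Fin N) → EuclideanSpace ℝ (Fin M),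
    ContDiffOn ℝ k F (Metric.ball x r) ∧ ∀ y ∈ X ∩ Metric.ball x r, F y = f y

/-- `φ : O → φ '' O ⊆ X` is a `C^k` local parametrization of `X`, with parameters in `ℝᵈ`: its
domain `O` is open in `ℝᵈ`, its range `φ '' O` is (relatively) open in `X`, and `φ` is a `C^k`
diffeomorphism of `O` onto `φ '' O` (the inverse is `ψ`). -/
structure IsLocalParametrization {N : ℕ} (k d : ℕ) (X : Set (EuclideanSpace ℝ (Fin N)))
    (O : Set (EuclideanSpace ℝ (Fin d)))
    (φ : EuclideanSpace ℝ (Fin d) → EuclideanSpace ℝ (Fin N)) : Prop where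
  isOpen_domain : IsOpen O
  isOpen_range : ∃ G : Set (EuclideanSpace ℝ (Fin N)), IsOpen G ∧ φ '' O = X ∩ G
  isCkOn : IsCkOn k O φ
  isCkOn_inverse : ∃ ψ : EuclideanSpace ℝ (Fin N) → EuclideanSpace ℝ (Fin d),
    IsCkOn k (φ '' O) ψ ∧ ∀ a ∈ O, ψ (φ a) = a

/-- `X ⊆ ℝᴺ` is a `d`-dimensional `C^k` manifold: every point of `X` lies in the range of a `C^k`
local parametrization with parameters in `ℝᵈ`. -/
def IsCkManifold {N : ℕ} (k d : ℕ) (X : Set (EuclideanSpace ℝ (Fin N))) : Prop :=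
  ∀ x ∈ X, ∃ (O : Set (EuclideanSpace ℝ (Fin d)))
    (φ : EuclideanSpace ℝ (Fin d) → EuclideanSpace ℝ (Fin N)),
    IsLocalParametrization k d X O φ ∧ x ∈ φ '' O

/-- The tangent space `T_x(X)` of a `d`-dimensional `C^1` manifold `X`: the range of the derivative
`Dφ(a)` of a local parametrization `φ` of `X` with `φ a = x`. -/
def tangentSpaceAt {N : ℕ} (d : ℕ) (X : Set (EuclideanSpace ℝ (Fin N)))
    (x : EuclideanSpace ℝ (Fin N)) : Set (EuclideanSpace ℝ (Fin N)) :=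
  {v | ∃ (O : Set (EuclideanSpace ℝ (Fin d)))
    (φ : EuclideanSpace ℝ (Fin d) → EuclideanSpace ℝ (Fin N)) (a : EuclideanSpace ℝ (Fin d)),
    IsLocalParametrization 1 d X O φ ∧ a ∈ O ∧ φ a = x ∧ v ∈ Set.range (fderiv ℝ φ a)}

/-- `g` is a normal vector field of the `d`-dimensional `C^1` manifold `X`. -/
def IsNormalVectorField {N : ℕ} (d : ℕ) (X : Set (EuclideanSpace ℝ (Fin N)))
    (g : EuclideanSpace ℝ (Fin N) → EuclideanSpace ℝ (Fin N)) : Prop :=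
  ∀ x ∈ X, ∀ v ∈ tangentSpaceAt d X x, inner ℝ (g x) v = 0

/-- The standing assumptions on the data of the equation `∇u(x) = λ(x) g(x)`: the set `U` is open
and `g : U → ℝⁿ \ {0}` is locally Lipschitz. -/
structure IsTDEField {n : ℕ} (U : Set (EuclideanSpace ℝ (Fin n)))
    (g : EuclideanSpace ℝ (Fin n) → EuclideanSpace ℝ (Fin n)) : Prop where
  isOpen : IsOpen U
  locallyLipschitzOn : LocallyLipschitzOn U g
  ne_zero : ∀ x ∈ U, g x ≠ 0

/-- `u : V → ℝ` is a normal solution to the total differential equation `∇u(x) = λ(x) g(x)`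
with `g` given on `U`. Only the values of `u` on `V` and of `g` on `U` matter. -/
structure IsNormalSolution {n : ℕ} (U : Set (EuclideanSpace ℝ (Fin n)))
    (g : EuclideanSpace ℝ (Fin n) → EuclideanSpace ℝ (Fin n))
    (V : Set (EuclideanSpace ℝ (Fin n))) (u : EuclideanSpace ℝ (Fin n) → ℝ) : Prop where
  isOpen_domain : IsOpen V
  domain_subset : V ⊆ U
  locallyLipschitzOn : LocallyLipschitzOn V u
  levelSet_manifold : ∀ c : ℝ, IsCkManifold 1 (n - 1) {x ∈ V | u x = c}
  levelSet_normal : ∀ c : ℝ, IsNormalVectorField (n - 1) {x ∈ V | u x = c} g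
  not_isLocalMax : ∀ x ∈ V, ¬ IsLocalMax u x
  not_isLocalMin : ∀ x ∈ V, ¬ IsLocalMin u x
  gradient_ne_zero : ∀ x ∈ V, DifferentiableAt ℝ u x → gradient u x ≠ 0

/-- The open positive quadrant `ℝ²₊₊`. -/
def positiveQuadrant : Set (EuclideanSpace ℝ (Fin 2)) := {x | 0 < x 0 ∧ 0 < x 1}

/-- The vector field `g` of the Arrow–Enthoven example (coordinates `x₁ = x 0`, `x₂ = x 1`). -/
noncomputable def arrowEnthovenField (x : EuclideanSpace ℝ (Fin 2)) : EuclideanSpace ℝ (Fin 2) :=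
  !₂[1 + (x 0 + 1) / √((x 0 + 1) ^ 2 + 4 * x 1), 2 / √((x 0 + 1) ^ 2 + 4 * x 1)]

/-- The function `u` of the Arrow–Enthoven example. -/
noncomputable def arrowEnthovenUtility (x : EuclideanSpace ℝ (Fin 2)) : ℝ :=
  (x 0 - 1) + √((x 0 + 1) ^ 2 + 4 * x 1)

open Filter Topology

/-! Squaring shows that `u = c` in the quadrant is the linear equation `4 x₂ + 2 (c + 2) x₁ = c (c +
2)`, so the level sets of `u` are line segments, with slopes that vary with `c`. Moreover `∇u = g`,
which makes `u` itself a normal solution.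

Let `w` be any normal solution. Since `g = ∇u` is normal to the level curves of `w`, `u` is locally
constant on them, so each contains a piece of the segment of `u` through each of its points. Hence
`w` is constant on these segments (`IsNormalSolution.eq_of_arrowEnthovenUtility_eq`): `w` is a
function of `u`.

Quasi-convexity: as `w` has no local maximum, on a range of values of `u` it never exceeds both
endpoint values (`IsNormalSolution.midpoint_le`), and the regions `a ≤ u ≤ b` are convex.

Non-convexity: a locally Lipschitz `w` has a point of differentiability. If `w` were convex,
comparing its tangent plane there with its values at half the height would force `Dw = 0`, because
the segments are not parallel; this contradicts `∇w ≠ 0`. -/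

theorem isOpen_positiveQuadrant : IsOpen positiveQuadrant := by
  have h0 : Continuous fun x : EuclideanSpace ℝ (Fin 2) => x 0 := by fun_prop
  have h1 : Continuous fun x : EuclideanSpace ℝ (Fin 2) => x 1 := by fun_prop
  exact (isOpen_lt continuous_const h0).inter (isOpen_lt continuous_const h1)

theorem convex_positiveQuadrant : Convex ℝ positiveQuadrant := by
  rintro x ⟨hx0, hx1⟩ y ⟨hy0, hy1⟩ a b ha hb hab
  have key : ∀ p q : ℝ, 0 < p → 0 < q → 0 < a * p + b * q := by
    intro p q hp hq
    rcases ha.eq_or_lt with rfl | ha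
    · have : b = 1 := by linarith
      subst this; linarith
    · have := mul_nonneg hb hq.le
      have := mul_pos ha hp
      linarith
  exact ⟨by simpa using key _ _ hx0 hy0, by simpa using key _ _ hx1 hy1⟩

/-! ### Level sets of `u` as line segments -/

theorem radicand_pos {x : EuclideanSpace ℝ (Fin 2)} (hx : x ∈ positiveQuadrant) :
    0 < (x 0 + 1) ^ 2 + 4 * x 1 := by
  have := hx.2
  positivity

theorem two_mul_lt_arrowEnthovenUtility {x : EuclideanSpace ℝ (Fin 2)}
    (hx : x ∈ positiveQuadrant) : 2 * x 0 < arrowEnthovenUtility x := by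
  have h : x 0 + 1 < √((x 0 + 1) ^ 2 + 4 * x 1) :=
    Real.lt_sqrt_of_sq_lt (by linarith [hx.2])
  unfold arrowEnthovenUtility
  linarith

theorem arrowEnthovenUtility_pos {x : EuclideanSpace ℝ (Fin 2)}
    (hx : x ∈ positiveQuadrant) : 0 < arrowEnthovenUtility x := by
  linarith [two_mul_lt_arrowEnthovenUtility hx, hx.1]

/-- With `s = u x`, this is `(s + 1 - x₁)² = (x₁ + 1)² + 4 x₂` expanded. -/
theorem arrowEnthovenUtility_line {x : EuclideanSpace ℝ (Fin 2)} (hx : x ∈ positiveQuadrant) :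
    4 * x 1 + 2 * (arrowEnthovenUtility x + 2) * x 0
      = arrowEnthovenUtility x * (arrowEnthovenUtility x + 2) := by
  have h := Real.sq_sqrt (radicand_pos hx).le
  unfold arrowEnthovenUtility
  linear_combination -h

/-- The defect in the linear inequality factors as `(c - s) (c + s + 2 - 2 x₁)` with `s = u x`; the
second factor is positive because `2 x₁ < s`. -/
theorem arrowEnthovenUtility_le_iff {x : EuclideanSpace ℝ (Fin 2)} (hx : x ∈ positiveQuadrant)
    {c : ℝ} (hc : 0 < c) :
    arrowEnthovenUtility x ≤ c ↔ 4 * x 1 + 2 * (c + 2) * x 0 ≤ c * (c + 2) := by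
  have h1 := arrowEnthovenUtility_line hx
  have h2 := two_mul_lt_arrowEnthovenUtility hx
  set s := arrowEnthovenUtility x
  have h3 : c * (c + 2) - (4 * x 1 + 2 * (c + 2) * x 0) = (c - s) * (c + s + 2 - 2 * x 0) := by
    linear_combination -h1
  rw [← sub_nonneg, ← sub_nonneg (a := c * (c + 2)), h3,
    mul_nonneg_iff_of_pos_right (by linarith)]

theorem le_arrowEnthovenUtility_iff {x : EuclideanSpace ℝ (Fin 2)} (hx : x ∈ positiveQuadrant)
    {c : ℝ} (hc : 0 < c) :
    c ≤ arrowEnthovenUtility x ↔ c * (c + 2) ≤ 4 * x 1 + 2 * (c + 2) * x 0 := by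
  have h1 := arrowEnthovenUtility_line hx
  have h2 := two_mul_lt_arrowEnthovenUtility hx
  set s := arrowEnthovenUtility x
  have h3 : (4 * x 1 + 2 * (c + 2) * x 0) - c * (c + 2) = (s - c) * (c + s + 2 - 2 * x 0) := by
    linear_combination h1
  rw [← sub_nonneg, ← sub_nonneg (b := c * (c + 2)), h3,
    mul_nonneg_iff_of_pos_right (by linarith)]

theorem arrowEnthovenUtility_eq_iff {x : EuclideanSpace ℝ (Fin 2)} (hx : x ∈ positiveQuadrant)
    {c : ℝ} (hc : 0 < c) :
    arrowEnthovenUtility x = c ↔ 4 * x 1 + 2 * (c + 2) * x 0 = c * (c + 2) := by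
  rw [le_antisymm_iff, le_antisymm_iff, arrowEnthovenUtility_le_iff hx hc,
    le_arrowEnthovenUtility_iff hx hc]

/-! ### Regularity of `u` and `g`, and `∇u = g` -/

theorem contDiffAt_arrowEnthovenUtility {x : EuclideanSpace ℝ (Fin 2)}
    (hx : x ∈ positiveQuadrant) : ContDiffAt ℝ 1 arrowEnthovenUtility x := by
  have := (radicand_pos hx).ne'
  unfold arrowEnthovenUtility
  exact (by fun_prop : ContDiffAt ℝ 1 (fun x : EuclideanSpace ℝ (Fin 2) => x 0 - 1) x).add
    ((by fun_prop : ContDiffAt ℝ 1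
      (fun x : EuclideanSpace ℝ (Fin 2) => (x 0 + 1) ^ 2 + 4 * x 1) x).sqrt this)

theorem contDiffAt_arrowEnthovenField {x : EuclideanSpace ℝ (Fin 2)}
    (hx : x ∈ positiveQuadrant) : ContDiffAt ℝ 1 arrowEnthovenField x := by
  have hr := radicand_pos hx
  have hs : ContDiffAt ℝ 1
      (fun x : EuclideanSpace ℝ (Fin 2) => √((x 0 + 1) ^ 2 + 4 * x 1)) x :=
    (by fun_prop : ContDiffAt ℝ 1
      (fun x : EuclideanSpace ℝ (Fin 2) => (x 0 + 1) ^ 2 + 4 * x 1) x).sqrt hr.ne'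
  have hne := (Real.sqrt_pos.2 hr).ne'
  rw [contDiffAt_euclidean]
  intro i
  fin_cases i
  · exact contDiffAt_const.add
      ((by fun_prop : ContDiffAt ℝ 1 (fun x : EuclideanSpace ℝ (Fin 2) => x 0 + 1) x).div hs hne)
  · exact contDiffAt_const.div hs hne

theorem hasFDerivAt_arrowEnthovenUtility {x : EuclideanSpace ℝ (Fin 2)}
    (hx : x ∈ positiveQuadrant) :
    HasFDerivAt arrowEnthovenUtility (innerSL ℝ (arrowEnthovenField x)) x := by
  have hr := radicand_pos hx
  have h0 : HasFDerivAt (fun x : EuclideanSpace ℝ (Fin 2) => x 0)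
      (EuclideanSpace.proj 0 : EuclideanSpace ℝ (Fin 2) →L[ℝ] ℝ) x :=
    (EuclideanSpace.proj 0 : EuclideanSpace ℝ (Fin 2) →L[ℝ] ℝ).hasFDerivAt
  have h1 : HasFDerivAt (fun x : EuclideanSpace ℝ (Fin 2) => x 1)
      (EuclideanSpace.proj 1 : EuclideanSpace ℝ (Fin 2) →L[ℝ] ℝ) x :=
    (EuclideanSpace.proj 1 : EuclideanSpace ℝ (Fin 2) →L[ℝ] ℝ).hasFDerivAt
  have h := (h0.sub_const 1).add
    ((((h0.add_const 1).pow 2).add (h1.const_mul 4)).sqrt hr.ne')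
  refine HasFDerivAt.congr_fderiv h ?_
  have hne := (Real.sqrt_pos.2 hr).ne'
  ext v
  simp [arrowEnthovenField, PiLp.inner_apply, Fin.sum_univ_two]
  field_simp
  ring

theorem arrowEnthovenField_ne_zero {x : EuclideanSpace ℝ (Fin 2)}
    (hx : x ∈ positiveQuadrant) : arrowEnthovenField x ≠ 0 := by
  intro h
  have h1 : arrowEnthovenField x 1 = 0 := by rw [h]; rfl
  have : 0 < arrowEnthovenField x 1 := by
    have := Real.sqrt_pos.2 (radicand_pos hx)
    simp only [arrowEnthovenField, PiLp.toLp_apply, Matrix.cons_val_one, Matrix.cons_val_fin_one]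
    positivity
  exact this.ne' h1

theorem locallyLipschitzOn_of_contDiffAt {E F : Type*} [NormedAddCommGroup E] [NormedSpace ℝ E]
    [NormedAddCommGroup F] [NormedSpace ℝ F] {s : Set E} {f : E → F}
    (h : ∀ x ∈ s, ContDiffAt ℝ 1 f x) : LocallyLipschitzOn s f := by
  intro x hx
  obtain ⟨K, t, ht, hK⟩ := (h x hx).exists_lipschitzOnWith
  exact ⟨K, t, mem_nhdsWithin_of_mem_nhds ht, hK⟩

theorem isTDEField_arrowEnthovenField : IsTDEField positiveQuadrant arrowEnthovenField where
  isOpen := isOpen_positiveQuadrant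
  locallyLipschitzOn := locallyLipschitzOn_of_contDiffAt fun _ => contDiffAt_arrowEnthovenField
  ne_zero _ := arrowEnthovenField_ne_zero

/-! ### Local parametrizations -/

theorem ContDiff.isCkOn {N M k : ℕ}
    {f : EuclideanSpace ℝ (Fin N) → EuclideanSpace ℝ (Fin M)} (hf : ContDiff ℝ k f)
    (X : Set (EuclideanSpace ℝ (Fin N))) : IsCkOn k X f :=
  fun _ _ => ⟨1, one_pos, f, hf.contDiffOn, fun _ _ => rfl⟩

theorem IsLocalParametrization.contDiffAt {N k d : ℕ} {X : Set (EuclideanSpace ℝ (Fin N))}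
    {O : Set (EuclideanSpace ℝ (Fin d))}
    {φ : EuclideanSpace ℝ (Fin d) → EuclideanSpace ℝ (Fin N)}
    (h : IsLocalParametrization k d X O φ) {a : EuclideanSpace ℝ (Fin d)} (ha : a ∈ O) :
    ContDiffAt ℝ k φ a := by
  obtain ⟨r, hr, F, hF, hFφ⟩ := h.isCkOn a ha
  refine (hF.contDiffAt (Metric.ball_mem_nhds a hr)).congr_of_eventuallyEq ?_
  filter_upwards [h.isOpen_domain.mem_nhds ha, Metric.ball_mem_nhds a hr] with y h1 h2
  exact (hFφ y ⟨h1, h2⟩).symm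

theorem IsLocalParametrization.map_mem {N k d : ℕ} {X : Set (EuclideanSpace ℝ (Fin N))}
    {O : Set (EuclideanSpace ℝ (Fin d))}
    {φ : EuclideanSpace ℝ (Fin d) → EuclideanSpace ℝ (Fin N)}
    (h : IsLocalParametrization k d X O φ) {a : EuclideanSpace ℝ (Fin d)} (ha : a ∈ O) :
    φ a ∈ X := by
  obtain ⟨G, -, hG⟩ := h.isOpen_range
  exact (hG ▸ Set.mem_image_of_mem φ ha : φ a ∈ X ∩ G).1

/-- The inverse extends to a `C^1` map `F` near `φ a`, and the chain rule for `F ∘ φ = id` gives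
`Dφ(a)` a left inverse. -/
theorem IsLocalParametrization.fderiv_injective {N d : ℕ} {X : Set (EuclideanSpace ℝ (Fin N))}
    {O : Set (EuclideanSpace ℝ (Fin d))}
    {φ : EuclideanSpace ℝ (Fin d) → EuclideanSpace ℝ (Fin N)}
    (h : IsLocalParametrization 1 d X O φ) {a : EuclideanSpace ℝ (Fin d)} (ha : a ∈ O) :
    Function.Injective (fderiv ℝ φ a) := by
  obtain ⟨ψ, hψ, hψφ⟩ := h.isCkOn_inverse
  obtain ⟨r, hr, F, hF, hFψ⟩ := hψ (φ a) (Set.mem_image_of_mem φ ha)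
  have hφ := (h.contDiffAt ha).differentiableAt (by simp)
  have hF' := (hF.contDiffAt (Metric.ball_mem_nhds _ hr)).differentiableAt (by simp)
  have hid : F ∘ φ =ᶠ[𝓝 a] id := by
    filter_upwards [h.isOpen_domain.mem_nhds ha,
      hφ.continuousAt (Metric.ball_mem_nhds _ hr)] with y h1 h2
    exact (hFψ _ ⟨Set.mem_image_of_mem φ h1, h2⟩).trans (hψφ y h1)
  have hcomp := (hF'.hasFDerivAt.comp a hφ.hasFDerivAt).unique
    ((hasFDerivAt_id a).congr_of_eventuallyEq hid)
  exact Function.LeftInverse.injective (g := fderiv ℝ F (φ a)) fun v => by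
    simpa using DFunLike.congr_fun hcomp v

/-! ### `u` is a normal solution -/

theorem levelSet_isCkManifold_arrowEnthovenUtility (c : ℝ) :
    IsCkManifold 1 1 {x ∈ positiveQuadrant | arrowEnthovenUtility x = c} := by
  rintro x ⟨hx, hxc⟩
  have hc : 0 < c := hxc ▸ arrowEnthovenUtility_pos hx
  -- The whole segment is one chart, parametrized by `x₁`; the bound `2 t < c` is the condition `x₂
  -- > 0`.
  let O : Set (EuclideanSpace ℝ (Fin 1)) := {t | 0 < t 0 ∧ 2 * t 0 < c}
  let φ : EuclideanSpace ℝ (Fin 1) → EuclideanSpace ℝ (Fin 2) :=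
    fun t => !₂[t 0, (c + 2) * (c - 2 * t 0) / 4]
  let ψ : EuclideanSpace ℝ (Fin 2) → EuclideanSpace ℝ (Fin 1) := fun y => !₂[y 0]
  have hφ : ContDiff ℝ 1 φ := by
    rw [contDiff_euclidean]
    intro i
    fin_cases i
    · exact (by fun_prop : ContDiff ℝ 1 fun t : EuclideanSpace ℝ (Fin 1) => t 0)
    · exact (by fun_prop : ContDiff ℝ 1
        fun t : EuclideanSpace ℝ (Fin 1) => (c + 2) * (c - 2 * t 0) / 4)
  have hψ : ContDiff ℝ 1 ψ := by
    rw [contDiff_euclidean]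
    intro i
    fin_cases i
    exact (by fun_prop : ContDiff ℝ 1 fun t : EuclideanSpace ℝ (Fin 2) => t 0)
  have hmem : ∀ y ∈ positiveQuadrant, arrowEnthovenUtility y = c → y ∈ φ '' O := by
    intro y hy hyc
    have h1 := (arrowEnthovenUtility_eq_iff hy hc).1 hyc
    have h2 := two_mul_lt_arrowEnthovenUtility hy
    refine ⟨!₂[y 0], ⟨hy.1, by simpa [hyc] using h2⟩, ?_⟩
    ext i
    fin_cases i
    · simp [φ]
    · simp [φ]; linarith
  refine ⟨O, φ, ⟨?_, ⟨positiveQuadrant, isOpen_positiveQuadrant, ?_⟩, hφ.isCkOn O,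
    ψ, hψ.isCkOn _, ?_⟩, hmem x hx hxc⟩
  · have h0 : Continuous fun x : EuclideanSpace ℝ (Fin 1) => x 0 := by fun_prop
    exact (isOpen_lt continuous_const h0).inter (isOpen_lt (h0.const_mul 2) continuous_const)
  · ext y
    constructor
    · rintro ⟨t, ⟨ht0, ht1⟩, rfl⟩
      have hq : φ t ∈ positiveQuadrant := by
        refine ⟨by simpa [φ] using ht0, ?_⟩
        have : 0 < c - 2 * t 0 := by linarith
        simp only [φ, Matrix.cons_val_one, Matrix.cons_val_fin_one]
        positivity
      refine ⟨⟨hq, (arrowEnthovenUtility_eq_iff hq hc).2 ?_⟩, hq⟩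
      simp [φ]; ring
    · rintro ⟨⟨hy, hyc⟩, -⟩
      exact hmem y hy hyc
  · intro t _
    ext i
    fin_cases i
    simp [φ, ψ]

theorem isNormalSolution_arrowEnthovenUtility :
    IsNormalSolution positiveQuadrant arrowEnthovenField positiveQuadrant
      arrowEnthovenUtility where
  isOpen_domain := isOpen_positiveQuadrant
  domain_subset := subset_rfl
  locallyLipschitzOn := locallyLipschitzOn_of_contDiffAt fun _ => contDiffAt_arrowEnthovenUtility
  levelSet_manifold := levelSet_isCkManifold_arrowEnthovenUtility
  levelSet_normal := by
    rintro c x ⟨hx, -⟩ v ⟨O, φ, a, hφ, ha, rfl, e, rfl⟩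
    have h1 := (hasFDerivAt_arrowEnthovenUtility hx).comp a
      ((hφ.contDiffAt ha).differentiableAt (by simp)).hasFDerivAt
    have h2 : arrowEnthovenUtility ∘ φ =ᶠ[𝓝 a] fun _ => c := by
      filter_upwards [hφ.isOpen_domain.mem_nhds ha] with y hy using (hφ.map_mem hy).2
    have h3 := h1.unique ((hasFDerivAt_const c a).congr_of_eventuallyEq h2)
    simpa using DFunLike.congr_fun h3 e
  not_isLocalMax x hx h := arrowEnthovenField_ne_zero hx <| by
    simpa using DFunLike.congr_fun
      (h.hasFDerivAt_eq_zero (hasFDerivAt_arrowEnthovenUtility hx)) (arrowEnthovenField x)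
  not_isLocalMin x hx h := arrowEnthovenField_ne_zero hx <| by
    simpa using DFunLike.congr_fun
      (h.hasFDerivAt_eq_zero (hasFDerivAt_arrowEnthovenUtility hx)) (arrowEnthovenField x)
  gradient_ne_zero x hx _ := by
    have : HasGradientAt arrowEnthovenUtility (arrowEnthovenField x) x := by
      rw [hasGradientAt_iff_hasFDerivAt]
      exact (hasFDerivAt_arrowEnthovenUtility hx).congr_fderiv (by ext; simp)
    rw [this.gradient]
    exact arrowEnthovenField_ne_zero hx

/-! ### Normal solutions are constant on the level segments of `u` -/

theorem arrowEnthovenField_one_pos {x : EuclideanSpace ℝ (Fin 2)}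
    (hx : x ∈ positiveQuadrant) : 0 < arrowEnthovenField x 1 := by
  have := Real.sqrt_pos.2 (radicand_pos hx)
  simp only [arrowEnthovenField, Matrix.cons_val_one, Matrix.cons_val_fin_one]
  positivity

/-- If `g` is a normal vector field of `X ⊆ ℝ²₊₊`, then `u` is locally constant along every
local parametrization of `X`. -/
theorem IsLocalParametrization.eventually_arrowEnthovenUtility_eq
    {X : Set (EuclideanSpace ℝ (Fin 2))} (hX : X ⊆ positiveQuadrant)
    (hg : IsNormalVectorField 1 X arrowEnthovenField)
    {O : Set (EuclideanSpace ℝ (Fin 1))}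
    {φ : EuclideanSpace ℝ (Fin 1) → EuclideanSpace ℝ (Fin 2)}
    (h : IsLocalParametrization 1 1 X O φ) {a : EuclideanSpace ℝ (Fin 1)} (ha : a ∈ O) :
    ∀ᶠ b in 𝓝 a, arrowEnthovenUtility (φ b) = arrowEnthovenUtility (φ a) := by
  obtain ⟨r, hr, hrO⟩ := Metric.isOpen_iff.1 h.isOpen_domain a ha
  have hd : ∀ b ∈ O, HasFDerivAt (arrowEnthovenUtility ∘ φ)
      (0 : EuclideanSpace ℝ (Fin 1) →L[ℝ] ℝ) b := by
    intro b hb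
    have h1 := (hasFDerivAt_arrowEnthovenUtility (hX (h.map_mem hb))).comp b
      ((h.contDiffAt hb).differentiableAt (by simp)).hasFDerivAt
    refine h1.congr_fderiv ?_
    ext e
    simpa using hg (φ b) (h.map_mem hb) _ ⟨O, φ, b, h, hb, rfl, _, rfl⟩
  filter_upwards [Metric.ball_mem_nhds a hr] with b hb
  exact Metric.isOpen_ball.is_const_of_fderiv_eq_zero (𝕜 := ℝ)
    (convex_ball a r).isPreconnected
    (fun y hy => (hd y (hrO hy)).differentiableAt.differentiableWithinAt)
    (fun y hy => (hd y (hrO hy)).fderiv) hb (Metric.mem_ball_self hr)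

theorem eq_add_smul_of_arrowEnthovenUtility_eq {x y : EuclideanSpace ℝ (Fin 2)}
    (hx : x ∈ positiveQuadrant) (hy : y ∈ positiveQuadrant)
    (h : arrowEnthovenUtility y = arrowEnthovenUtility x) :
    y = x + ((y 0 - x 0) / 2) • !₂[2, -(arrowEnthovenUtility x + 2)] := by
  have h1 := arrowEnthovenUtility_line hx
  have h2 := arrowEnthovenUtility_line hy
  rw [h] at h2
  ext i
  fin_cases i
  · simp
  · simp; linarith

/-- A chart of the level curve of `w` stays on the line `u = u x` near `x`; it remains to see that
it covers a neighbourhood of `x` in that line. -/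
theorem IsNormalSolution.eventually_eq_along_line {w : EuclideanSpace ℝ (Fin 2) → ℝ}
    (hw : IsNormalSolution positiveQuadrant arrowEnthovenField positiveQuadrant w)
    {x : EuclideanSpace ℝ (Fin 2)} (hx : x ∈ positiveQuadrant) :
    ∀ᶠ s : ℝ in 𝓝 0, w (x + s • !₂[2, -(arrowEnthovenUtility x + 2)]) = w x := by
  set X := {y ∈ positiveQuadrant | w y = w x} with hXdef
  have hX : X ⊆ positiveQuadrant := fun y hy => hy.1
  have hg : IsNormalVectorField 1 X arrowEnthovenField := hw.levelSet_normal (w x)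
  obtain ⟨O, φ, h, a, ha, rfl⟩ :
      ∃ (O : Set (EuclideanSpace ℝ (Fin 1)))
        (φ : EuclideanSpace ℝ (Fin 1) → EuclideanSpace ℝ (Fin 2)),
        IsLocalParametrization 1 1 X O φ ∧ x ∈ φ '' O :=
    hw.levelSet_manifold (w x) x ⟨hx, rfl⟩
  have hstrict : HasStrictFDerivAt φ (fderiv ℝ φ a) a :=
    (h.contDiffAt ha).hasStrictFDerivAt (by simp)
  let π₀ : EuclideanSpace ℝ (Fin 2) →L[ℝ] ℝ := EuclideanSpace.proj 0
  let τ : EuclideanSpace ℝ (Fin 1) → ℝ := fun b => (φ b 0 - φ a 0) / 2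
  let τ' : EuclideanSpace ℝ (Fin 1) →L[ℝ] ℝ := (2⁻¹ : ℝ) • π₀.comp (fderiv ℝ φ a)
  have hτ : HasStrictFDerivAt τ τ' a := by
    have h1 := ((π₀.hasStrictFDerivAt.comp a hstrict).sub_const (φ a 0)).const_smul (2⁻¹ : ℝ)
    refine h1.congr_of_eventuallyEq (Eventually.of_forall fun b => ?_)
    simp [τ, π₀, div_eq_inv_mul]
  -- Otherwise the tangent vector has first coordinate `0`; being orthogonal to `g`, whose second
  -- coordinate is positive, it vanishes, against injectivity of `Dφ(a)`.
  have hsurj : τ'.range = ⊤ := by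
    rw [LinearMap.range_eq_top]
    apply LinearMap.surjective
    intro h0
    let e : EuclideanSpace ℝ (Fin 1) := !₂[1]
    have he : e ≠ 0 := fun h => by simpa [e] using congrArg (fun v => v 0) h
    have hv0 : fderiv ℝ φ a e 0 = 0 := by
      simpa [τ', π₀] using DFunLike.congr_fun h0 e
    have hv : inner ℝ (arrowEnthovenField (φ a)) (fderiv ℝ φ a e) = 0 :=
      hg (φ a) (h.map_mem ha) _ ⟨O, φ, a, h, ha, rfl, e, rfl⟩
    have hv1 : fderiv ℝ φ a e 1 = 0 := by
      simpa [PiLp.inner_apply, Fin.sum_univ_two, hv0,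
        (arrowEnthovenField_one_pos hx).ne'] using hv
    refine he (h.fderiv_injective ha ?_)
    rw [map_zero]
    ext i
    fin_cases i
    · exact hv0
    · exact hv1
  -- By openness of `τ` at `a`, every small displacement along the line is attained by the chart.
  have hmap := hτ.map_nhds_eq_of_surj hsurj
  have hτa : τ a = 0 := by simp [τ]
  rw [hτa] at hmap
  rw [← hmap, eventually_map]
  filter_upwards [h.isOpen_domain.mem_nhds ha,
    h.eventually_arrowEnthovenUtility_eq hX hg ha] with b hb hub
  have hbX := h.map_mem hb
  rw [← eq_add_smul_of_arrowEnthovenUtility_eq hx hbX.1 hub]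
  exact hbX.2

/-- Local constancy makes `w` have derivative `0` along the segment from `x` to `y`, which stays in
the quadrant and in one level set of `u`. -/
theorem IsNormalSolution.eq_of_arrowEnthovenUtility_eq {w : EuclideanSpace ℝ (Fin 2) → ℝ}
    (hw : IsNormalSolution positiveQuadrant arrowEnthovenField positiveQuadrant w)
    {x y : EuclideanSpace ℝ (Fin 2)} (hx : x ∈ positiveQuadrant) (hy : y ∈ positiveQuadrant)
    (h : arrowEnthovenUtility y = arrowEnthovenUtility x) : w y = w x := by
  set d : EuclideanSpace ℝ (Fin 2) := !₂[2, -(arrowEnthovenUtility x + 2)] with hd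
  set k := (y 0 - x 0) / 2
  have hyx : y = x + k • d := eq_add_smul_of_arrowEnthovenUtility_eq hx hy h
  let p : ℝ → EuclideanSpace ℝ (Fin 2) := fun s => x + (s * k) • d
  have hp : ∀ s ∈ Set.Icc (0 : ℝ) 1, p s ∈ positiveQuadrant := by
    intro s hs
    have : p s = (1 - s) • x + s • y := by
      simp only [p, hyx, sub_smul, one_smul, smul_add, mul_smul]
      abel
    rw [this]
    exact convex_positiveQuadrant hx hy (by linarith [hs.2]) hs.1 (by ring)
  have hup : ∀ s ∈ Set.Icc (0 : ℝ) 1, arrowEnthovenUtility (p s) = arrowEnthovenUtility x := by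
    intro s hs
    rw [arrowEnthovenUtility_eq_iff (hp s hs) (arrowEnthovenUtility_pos hx)]
    have := arrowEnthovenUtility_line hx
    simp [p, hd]
    linarith
  have hderiv : ∀ s ∈ Set.Icc (0 : ℝ) 1, HasDerivAt (fun s => w (p s)) 0 s := by
    intro s hs
    refine (hasDerivAt_const s (w (p s))).congr_of_eventuallyEq ?_
    have h1 := hw.eventually_eq_along_line (hp s hs)
    rw [hup s hs] at h1
    have h2 : Tendsto (fun t => (t - s) * k) (𝓝 s) (𝓝 0) := by
      have : Continuous fun t : ℝ => (t - s) * k := by fun_prop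
      simpa using this.tendsto s
    filter_upwards [h2.eventually h1] with t ht
    rw [← ht]
    congr 1
    simp only [p, add_assoc, ← add_smul, ← hd]
    congr 2
    ring
  have := constant_of_has_deriv_right_zero (f := fun s => w (p s)) (a := 0) (b := 1)
    (fun s hs => (hderiv s hs).continuousAt.continuousWithinAt)
    (fun s hs => (hderiv s (Set.Ico_subset_Icc_self hs)).hasDerivWithinAt) 1 (by simp)
  simpa [p, hyx] using this

/-! ### Quasi-convexity -/

/-- The midpoint of the segment `{u = s}` in `ℝ²₊₊`. -/
noncomputable def arrowEnthovenMidpoint (s : ℝ) : EuclideanSpace ℝ (Fin 2) :=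
  !₂[s / 4, s * (s + 2) / 8]

theorem arrowEnthovenMidpoint_mem {s : ℝ} (hs : 0 < s) :
    arrowEnthovenMidpoint s ∈ positiveQuadrant := by
  constructor
  · simpa [arrowEnthovenMidpoint] using hs
  · simp only [arrowEnthovenMidpoint, Matrix.cons_val_one, Matrix.cons_val_fin_one]
    positivity

theorem arrowEnthovenUtility_midpoint {s : ℝ} (hs : 0 < s) :
    arrowEnthovenUtility (arrowEnthovenMidpoint s) = s := by
  rw [arrowEnthovenUtility_eq_iff (arrowEnthovenMidpoint_mem hs) hs]
  simp [arrowEnthovenMidpoint]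
  ring

theorem continuous_arrowEnthovenMidpoint : Continuous arrowEnthovenMidpoint := by
  refine (PiLp.continuous_toLp 2 _).comp (continuous_pi fun i => ?_)
  fin_cases i
  · exact (by fun_prop : Continuous fun s : ℝ => s / 4)
  · exact (by fun_prop : Continuous fun s : ℝ => s * (s + 2) / 8)

theorem LocallyLipschitzOn.continuousAt_of_isOpen {α β : Type*} [PseudoEMetricSpace α]
    [PseudoEMetricSpace β] {s : Set α} {f : α → β} (hf : LocallyLipschitzOn s f) (hs : IsOpen s)
    {x : α} (hx : x ∈ s) : ContinuousAt f x := by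
  obtain ⟨K, t, ht, hK⟩ := hf hx
  rw [hs.nhdsWithin_eq hx] at ht
  exact hK.continuousOn.continuousAt ht

theorem IsNormalSolution.eq_midpoint {w : EuclideanSpace ℝ (Fin 2) → ℝ}
    (hw : IsNormalSolution positiveQuadrant arrowEnthovenField positiveQuadrant w)
    {x : EuclideanSpace ℝ (Fin 2)} (hx : x ∈ positiveQuadrant) :
    w x = w (arrowEnthovenMidpoint (arrowEnthovenUtility x)) :=
  have h := arrowEnthovenUtility_pos hx
  hw.eq_of_arrowEnthovenUtility_eq (arrowEnthovenMidpoint_mem h) hx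
    (arrowEnthovenUtility_midpoint h).symm

/-- Otherwise the maximum over `[a, b]` is attained at an interior `m`. Since `w` depends only on
`u`, it is a local maximum of `w` in the plane, which is excluded. -/
theorem IsNormalSolution.midpoint_le {w : EuclideanSpace ℝ (Fin 2) → ℝ}
    (hw : IsNormalSolution positiveQuadrant arrowEnthovenField positiveQuadrant w)
    {a b s r : ℝ} (ha : 0 < a) (has : a ≤ s) (hsb : s ≤ b)
    (hra : w (arrowEnthovenMidpoint a) ≤ r) (hrb : w (arrowEnthovenMidpoint b) ≤ r) :
    w (arrowEnthovenMidpoint s) ≤ r := by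
  by_contra! hlt
  have hcont : ContinuousOn (fun s => w (arrowEnthovenMidpoint s)) (Set.Icc a b) := by
    intro t ht
    have h0 : 0 < t := ha.trans_le ht.1
    exact ((hw.locallyLipschitzOn.continuousAt_of_isOpen isOpen_positiveQuadrant
      (arrowEnthovenMidpoint_mem h0)).comp
        continuous_arrowEnthovenMidpoint.continuousAt).continuousWithinAt
  obtain ⟨m, hm, hmax⟩ := isCompact_Icc.exists_isMaxOn ⟨s, has, hsb⟩ hcont
  have hlt' : r < w (arrowEnthovenMidpoint m) := hlt.trans_le (hmax ⟨has, hsb⟩)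
  have ham : a < m := hm.1.lt_of_ne fun h => (hra.trans_lt (h ▸ hlt')).false
  have hmb : m < b := hm.2.lt_of_ne fun h => (hrb.trans_lt (h ▸ hlt')).false
  have hm0 := ha.trans ham
  have hpm := arrowEnthovenMidpoint_mem hm0
  refine hw.not_isLocalMax _ hpm ?_
  have hu := (contDiffAt_arrowEnthovenUtility hpm).continuousAt
  rw [ContinuousAt, arrowEnthovenUtility_midpoint hm0] at hu
  filter_upwards [isOpen_positiveQuadrant.mem_nhds hpm, hu (Ioo_mem_nhds ham hmb)] with y hy hyu
  rw [hw.eq_midpoint hy]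
  exact hmax (Set.Ioo_subset_Icc_self hyu)

theorem convex_arrowEnthovenUtility_mem_Icc {a b : ℝ} (ha : 0 < a) (hb : 0 < b) :
    Convex ℝ {x ∈ positiveQuadrant | a ≤ arrowEnthovenUtility x ∧ arrowEnthovenUtility x ≤ b} := by
  rintro x ⟨hx, hxa, hxb⟩ y ⟨hy, hya, hyb⟩ p q hp hq hpq
  have hz := convex_positiveQuadrant hx hy hp hq hpq
  rw [le_arrowEnthovenUtility_iff hx ha] at hxa
  rw [le_arrowEnthovenUtility_iff hy ha] at hya
  rw [arrowEnthovenUtility_le_iff hx hb] at hxb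
  rw [arrowEnthovenUtility_le_iff hy hb] at hyb
  obtain rfl : q = 1 - p := by linarith
  refine ⟨hz, (le_arrowEnthovenUtility_iff hz ha).2 ?_, (arrowEnthovenUtility_le_iff hz hb).2 ?_⟩
  · have h1 := mul_le_mul_of_nonneg_left hxa hp
    have h2 := mul_le_mul_of_nonneg_left hya hq
    simp only [PiLp.add_apply, PiLp.smul_apply, smul_eq_mul]
    linarith
  · have h1 := mul_le_mul_of_nonneg_left hxb hp
    have h2 := mul_le_mul_of_nonneg_left hyb hq
    simp only [PiLp.add_apply, PiLp.smul_apply, smul_eq_mul]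
    linarith

theorem IsNormalSolution.quasiconvexOn {w : EuclideanSpace ℝ (Fin 2) → ℝ}
    (hw : IsNormalSolution positiveQuadrant arrowEnthovenField positiveQuadrant w) :
    QuasiconvexOn ℝ positiveQuadrant w := by
  rintro r x ⟨hx, hxr⟩ y ⟨hy, hyr⟩ p q hp hq hpq
  rw [hw.eq_midpoint hx] at hxr
  rw [hw.eq_midpoint hy] at hyr
  have hux := arrowEnthovenUtility_pos hx
  have huy := arrowEnthovenUtility_pos hy
  have hz := convex_positiveQuadrant hx hy hp hq hpq
  refine ⟨hz, ?_⟩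
  rw [hw.eq_midpoint hz]
  rcases le_total (arrowEnthovenUtility x) (arrowEnthovenUtility y) with h | h
  · obtain ⟨-, h1, h2⟩ := convex_arrowEnthovenUtility_mem_Icc hux huy
      ⟨hx, le_rfl, h⟩ ⟨hy, h, le_rfl⟩ hp hq hpq
    exact hw.midpoint_le hux h1 h2 hxr hyr
  · obtain ⟨-, h1, h2⟩ := convex_arrowEnthovenUtility_mem_Icc huy hux
      ⟨hx, h, le_rfl⟩ ⟨hy, le_rfl, h⟩ hp hq hpq
    exact hw.midpoint_le huy h1 h2 hyr hxr

/-! ### Non-convexity -/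

theorem ConvexOn.add_fderiv_le {E : Type*} [NormedAddCommGroup E] [NormedSpace ℝ E] {s : Set E}
    {f : E → ℝ} (hf : ConvexOn ℝ s f) {x y : E} (hx : x ∈ s) (hy : y ∈ s) {L : E →L[ℝ] ℝ}
    (hL : HasFDerivAt f L x) : f x + L (y - x) ≤ f y := by
  have h1 := hf.comp_affineMap (AffineMap.lineMap x y)
  have h2 : HasDerivAt (f ∘ AffineMap.lineMap (k := ℝ) x y) (L (y - x)) 0 := by
    refine HasFDerivAt.comp_hasDerivAt (0 : ℝ) ?_ AffineMap.hasDerivAt_lineMap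
    simpa using hL
  have h3 := h1.le_slope_of_hasDerivAt (x := 0) (y := 1) (by simpa using hx) (by simpa using hy)
    one_pos h2
  simp [slope] at h3
  rw [map_sub]
  linarith

/-- Rademacher's theorem on a neighbourhood, which has positive measure. -/
theorem LocallyLipschitzOn.exists_differentiableAt {E F : Type*} [NormedAddCommGroup E]
    [NormedSpace ℝ E] [FiniteDimensional ℝ E] [MeasurableSpace E] [BorelSpace E]
    [NormedAddCommGroup F] [NormedSpace ℝ F] [FiniteDimensional ℝ F] {s : Set E} {f : E → F}
    (hf : LocallyLipschitzOn s f) (hs : IsOpen s) (hne : s.Nonempty) :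
    ∃ x ∈ s, DifferentiableAt ℝ f x := by
  obtain ⟨x, hx⟩ := hne
  obtain ⟨K, t, ht, hK⟩ := hf hx
  rw [hs.nhdsWithin_eq hx] at ht
  have hst : s ∩ interior t ∈ 𝓝 x := inter_mem (hs.mem_nhds hx) (interior_mem_nhds.2 ht)
  have hpos : (MeasureTheory.Measure.addHaar : MeasureTheory.Measure E) (s ∩ interior t) ≠ 0 :=
    (MeasureTheory.Measure.measure_pos_of_mem_nhds _ hst).ne'
  obtain ⟨y, hy, hyd⟩ := ((MeasureTheory.frequently_ae_mem_iff.2 hpos).and_eventually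
    hK.ae_differentiableWithinAt_of_mem).exists
  exact ⟨y, hy.1, (hyd (interior_subset hy.2)).differentiableAt (mem_interior_iff_mem_nhds.1 hy.2)⟩

/-- The curve in `{x₂ = b}` parametrized by the value of `u`. -/
noncomputable def arrowEnthovenHorizontal (b s : ℝ) : EuclideanSpace ℝ (Fin 2) :=
  !₂[s / 2 - 2 * b / (s + 2), b]

theorem arrowEnthovenUtility_horizontal {b s : ℝ} (hs : 0 < s)
    (h : arrowEnthovenHorizontal b s ∈ positiveQuadrant) :
    arrowEnthovenUtility (arrowEnthovenHorizontal b s) = s := by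
  rw [arrowEnthovenUtility_eq_iff h hs]
  simp [arrowEnthovenHorizontal]
  field_simp
  ring

theorem arrowEnthovenHorizontal_eq {x : EuclideanSpace ℝ (Fin 2)} (hx : x ∈ positiveQuadrant) :
    arrowEnthovenHorizontal (x 1) (arrowEnthovenUtility x) = x := by
  have h := arrowEnthovenUtility_line hx
  have hu := arrowEnthovenUtility_pos hx
  ext i
  fin_cases i
  · simp [arrowEnthovenHorizontal]
    field_simp
    linarith
  · simp [arrowEnthovenHorizontal]

theorem hasDerivAt_arrowEnthovenHorizontal (b : ℝ) {s : ℝ} (hs : 0 < s) :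
    HasDerivAt (arrowEnthovenHorizontal b) !₂[1 / 2 + 2 * b / (s + 2) ^ 2, 0] s := by
  refine HasFDerivAt.comp_hasDerivAt s
    (PiLp.continuousLinearEquiv 2 ℝ fun _ : Fin 2 => ℝ).symm.hasFDerivAt
    (f := fun s => ![s / 2 - 2 * b / (s + 2), b])
    (f' := ![1 / 2 + 2 * b / (s + 2) ^ 2, 0]) (hasDerivAt_pi.2 fun i => ?_)
  fin_cases i
  · have h := ((hasDerivAt_id s).div_const 2).sub
      (((hasDerivAt_id s).add_const 2).fun_inv (by simp; positivity) |>.const_mul (2 * b))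
    refine HasDerivAt.congr_deriv (f := fun s => s / 2 - 2 * b / (s + 2)) h ?_
    simp
    ring
  · exact hasDerivAt_const s b

theorem IsNormalSolution.not_convexOn {w : EuclideanSpace ℝ (Fin 2) → ℝ}
    (hw : IsNormalSolution positiveQuadrant arrowEnthovenField positiveQuadrant w) :
    ¬ ConvexOn ℝ positiveQuadrant w := by
  intro hconv
  obtain ⟨x, hx, hd⟩ := hw.locallyLipschitzOn.exists_differentiableAt isOpen_positiveQuadrant
    ⟨_, arrowEnthovenMidpoint_mem one_pos⟩
  have hL := hd.hasFDerivAt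
  set L := fderiv ℝ w x
  set c := arrowEnthovenUtility x with hc
  have hc0 : 0 < c := arrowEnthovenUtility_pos hx
  set b := x 1 with hb
  have hb0 : 0 < b := hx.2
  have hxc : arrowEnthovenHorizontal b c = x := arrowEnthovenHorizontal_eq hx
  have hLd : L !₂[2, -(c + 2)] = 0 := by
    have h1 : HasDerivAt (fun s : ℝ => x + s • (!₂[2, -(c + 2)] : EuclideanSpace ℝ (Fin 2)))
        !₂[2, -(c + 2)] 0 := by
      simpa using ((hasDerivAt_id (0 : ℝ)).smul_const
        (!₂[2, -(c + 2)] : EuclideanSpace ℝ (Fin 2))).const_add x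
    have h2 := HasFDerivAt.comp_hasDerivAt (0 : ℝ) (l := w) (l' := L) (by simpa using hL) h1
    exact h2.unique ((hasDerivAt_const 0 (w x)).congr_of_eventuallyEq
      (hw.eventually_eq_along_line hx))
  have hγ := hasDerivAt_arrowEnthovenHorizontal b hc0
  have hγ' := hasDerivAt_arrowEnthovenHorizontal (b / 2) hc0
  -- Moving down the segment from height `b` to `b / 2` increases `x₁` by `b / (c + 2)`.
  have hx' : arrowEnthovenHorizontal (b / 2) c ∈ positiveQuadrant := by
    refine ⟨?_, by simpa [arrowEnthovenHorizontal] using hb0⟩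
    have h1 : 0 < arrowEnthovenHorizontal b c 0 := hxc.symm ▸ hx.1
    have h2 : 0 < b / (c + 2) := by positivity
    simp only [arrowEnthovenHorizontal, Matrix.cons_val_zero] at h1 ⊢
    have h3 : c / 2 - 2 * (b / 2) / (c + 2) = (c / 2 - 2 * b / (c + 2)) + b / (c + 2) := by ring
    linarith
  -- The tangent plane at `x` bounds `w` below at height `b / 2`, where `w` takes the same values as
  -- at height `b`; equality holds at `s = c` because `L` vanishes along the segment.
  have hmin : IsLocalMin (fun s => w (arrowEnthovenHorizontal b s)
      - L (arrowEnthovenHorizontal (b / 2) s)) c := by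
    have e1 : ∀ᶠ s in 𝓝 c, arrowEnthovenHorizontal b s ∈ positiveQuadrant :=
      hγ.continuousAt.eventually_mem (isOpen_positiveQuadrant.mem_nhds (by rwa [hxc]))
    have e2 : ∀ᶠ s in 𝓝 c, arrowEnthovenHorizontal (b / 2) s ∈ positiveQuadrant :=
      hγ'.continuousAt.eventually_mem (isOpen_positiveQuadrant.mem_nhds hx')
    have key : ∀ s, 0 < s → arrowEnthovenHorizontal b s ∈ positiveQuadrant →
        arrowEnthovenHorizontal (b / 2) s ∈ positiveQuadrant →
        w (arrowEnthovenHorizontal b s) = w (arrowEnthovenHorizontal (b / 2) s) := by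
      intro s hs h1 h2
      refine hw.eq_of_arrowEnthovenUtility_eq h2 h1 ?_
      rw [arrowEnthovenUtility_horizontal hs h1, arrowEnthovenUtility_horizontal hs h2]
    have hLx : L (arrowEnthovenHorizontal (b / 2) c) = L x := by
      rw [eq_add_smul_of_arrowEnthovenUtility_eq hx hx' (arrowEnthovenUtility_horizontal hc0 hx'),
        map_add, map_smul, hLd, smul_zero, add_zero]
    filter_upwards [e1, e2, lt_mem_nhds hc0] with s h1 h2 hs
    have h3 := hconv.add_fderiv_le hx h2 hL
    rw [map_sub] at h3
    rw [key s hs h1 h2, hxc, hLx]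
    linarith
  have hderiv := hmin.hasDerivAt_eq_zero
    ((HasFDerivAt.comp_hasDerivAt c (l := w) (l' := L) (by rwa [hxc]) hγ).sub
      (L.hasFDerivAt.comp_hasDerivAt c hγ'))
  -- The minimum condition says that `L` agrees on the velocities of the two curves. These differ by
  -- a positive multiple of the first basis vector, since the segments are not parallel.
  have hLe : L !₂[1, 0] = 0 := by
    rw [← map_sub] at hderiv
    have : (!₂[1 / 2 + 2 * b / (c + 2) ^ 2, 0] - !₂[1 / 2 + 2 * (b / 2) / (c + 2) ^ 2, 0] :
        EuclideanSpace ℝ (Fin 2)) = (b / (c + 2) ^ 2) • !₂[1, 0] := by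
      ext i
      fin_cases i
      · simp; ring
      · simp
    rw [this, map_smul, smul_eq_mul] at hderiv
    exact (mul_eq_zero.1 hderiv).resolve_left (by positivity)
  refine hw.gradient_ne_zero x hx hd ?_
  have hL0 : L = 0 := by
    ext v
    have hv : v = (v 0 + 2 * v 1 / (c + 2)) • (!₂[1, 0] : EuclideanSpace ℝ (Fin 2))
        + (-(v 1) / (c + 2)) • !₂[2, -(c + 2)] := by
      ext i
      fin_cases i
      · simp; ring
      · simp; field_simp; ring
    rw [hv, map_add, map_smul, map_smul, hLe, hLd]
    simp
  rw [gradient, show fderiv ℝ w x = 0 from hL0, map_zero]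

theorem mainTheorem10 :
    IsTDEField positiveQuadrant arrowEnthovenField ∧
    IsNormalSolution positiveQuadrant arrowEnthovenField positiveQuadrant arrowEnthovenUtility ∧
    (∀ w : EuclideanSpace ℝ (Fin 2) → ℝ,
      IsNormalSolution positiveQuadrant arrowEnthovenField positiveQuadrant w →
        QuasiconvexOn ℝ positiveQuadrant w) ∧
    ¬ ∃ w : EuclideanSpace ℝ (Fin 2) → ℝ,
      IsNormalSolution positiveQuadrant arrowEnthovenField positiveQuadrant w ∧
        ConvexOn ℝ positiveQuadrant w :=
  ⟨isTDEField_arrowEnthovenField, isNormalSolution_arrowEnthovenUtility,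
    fun _ hw => hw.quasiconvexOn, fun ⟨_, hw, hconv⟩ => hw.not_convexOn hconv⟩
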